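/- Let $d\ge 2$, let $\Lambda$ be a finite set with $|\Lambda|>1$, let $A_\lambda\in GL(d,\mathbb R)$ ($\lambda\in\Lambda$) satisfy $\|A_\lambda\|<1$ in the Euclidean operator norm, and let $p=(p_\lambda)_{\lambda\in\Lambda}$ be a probability vector with all $p_\lambda>0$. Let $\mu=p^{\mathbb N}$ be the Bernoulli measure on $\Omega=\Lambda^{\mathbb N}$. Let $\alpha_1(M)\ge\dots\ge\alpha_d(M)$ denote the singular values of a matrix $M$, and let $0>\gamma_1\ge\dots\ge\gamma_d>-\infty$ be the Lyapunov exponents, i.e. for $\mu$-a.e. $\omega$, $$\gamma_i=\lim_{n\to\infty}\frac1n\log\alpha_i(A_{\omega_0}\cdots A_{\omega_{n-1}})\qquad(1\le i\le d).$$ Put $h_\mu=-\sum_{\lambda}p_\lambda\log p_\lambda$, $k=\max\{0\le i\le d: 0<h_\mu+\gamma_1+\dots+\gamma_i\}$, and define the Lyapunov dimension by $$D(\mu)=\begin{cases}k-\dfrac{h_\mu+\gamma_1+\dots+\gamma_k}{\gamma_{k+1}},&k<d,\\[2mm]-d\cdot\dfrac{h_\mu}{\gamma_1+\dots+\gamma_d},&k=d.\end{cases}$$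 For $v=(v_\lambda)_{\lambda\in\Lambda}\in(\mathbb R^d)^{\Lambda}$ let $\varphi_{v,\lambda}(x)=A_\lambda x+v_\lambda$, let $\pi_v(\omega)=\lim_{n}\varphi_{v,\omega_0}\circ\dots\circ\varphi_{v,\omega_n}(0)$, and let $\pi_v\mu=\mu\circ\pi_v^{-1}$. Then for every $v\in(\mathbb R^d)^{\Lambda}$ and for $\pi_v\mu$-a.e. $x\in\mathbb R^d$, $$\limsup_{\epsilon\downarrow0}\frac{\log\pi_v\mu(B(x,\epsilon))}{\log\epsilon}\le D(\mu),$$ where $B(x,\epsilon)$ is the closed Euclidean ball of centre $x$ and radius $\epsilon$. -/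

import Mathlib

open MeasureTheory Filter Topology

noncomputable section

namespace SelfAffine

/-- The Bernoulli measure `p^ℕ` on the space of sequences over `Λ`. -/
def bernoulli {Λ : Type*} [MeasurableSpace Λ] (p : PMF Λ) : Measure (ℕ → Λ) :=
  Measure.infinitePi fun _ : ℕ => p.toMeasure

/-- The matrix product `A_{ω 0} * ⋯ * A_{ω (n-1)}`. -/
def prefixProd {Λ : Type*} {d : ℕ} (A : Λ → GL (Fin d) ℝ) (ω : ℕ → Λ) (n : ℕ) :
    GL (Fin d) ℝ :=
  ((List.range n).map fun j => A (ω j)).prod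

/-- A matrix as an operator on `ℝ^d` with the Euclidean norm; the norm of this operator is the
Euclidean operator norm of the matrix. -/
def toOp {d : ℕ} (M : GL (Fin d) ℝ) :
    EuclideanSpace ℝ (Fin d) →L[ℝ] EuclideanSpace ℝ (Fin d) :=
  Matrix.toEuclideanCLM (n := Fin d) (𝕜 := ℝ) (M : Matrix (Fin d) (Fin d) ℝ)

/-- The singular values of `M`, in decreasing order and indexed from `0`: `singularValue M i` is
`α_{i+1}(M)`. -/
def singularValue {d : ℕ} (M : GL (Fin d) ℝ) (i : ℕ) : ℝ :=
  (toOp M : EuclideanSpace ℝ (Fin d) →ₗ[ℝ] EuclideanSpace ℝ (Fin d)).singularValues i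

/-- The finite time exponents `(1/n) log α_{i+1}(A_{ω 0} * ⋯ * A_{ω (n-1)})`. -/
def finiteExponent {Λ : Type*} {d : ℕ} (A : Λ → GL (Fin d) ℝ) (i : ℕ) (ω : ℕ → Λ) (n : ℕ) : ℝ :=
  1 / (n : ℝ) * Real.log (singularValue (prefixProd A ω n) i)

/-- The Lyapunov exponent `γ_{i+1}` of the Bernoulli measure `p^ℕ` and the matrices `A` (indexed
from `0`): the constant value that `lim_n (1/n) log α_{i+1}(A_{ω 0} * ⋯ * A_{ω (n-1)})` has for
almost every `ω`. The upper limit and the essential supremum only turn "the almost sure value of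
the limit" into a total expression, see `lyapunovExponent_eq`. -/
def lyapunovExponent {Λ : Type*} [MeasurableSpace Λ] {d : ℕ} (p : PMF Λ) (A : Λ → GL (Fin d) ℝ)
    (i : ℕ) : ℝ :=
  essSup (fun ω => limsup (finiteExponent A i ω) atTop) (bernoulli p)

/-- The Lyapunov exponent is the almost sure limit of the finite time exponents. -/
theorem lyapunovExponent_eq {Λ : Type*} [MeasurableSpace Λ] {d : ℕ} (p : PMF Λ)
    (A : Λ → GL (Fin d) ℝ) (i : ℕ) (c : ℝ)
    (h : ∀ᵐ ω ∂bernoulli p, Tendsto (finiteExponent A i ω) atTop (𝓝 c)) :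
    lyapunovExponent p A i = c := by
  have : IsProbabilityMeasure (bernoulli p) := by unfold bernoulli; infer_instance
  have h2 : (fun ω => limsup (finiteExponent A i ω) atTop) =ᵐ[bernoulli p] fun _ => c :=
    h.mono fun ω hω => hω.limsup_eq
  rw [lyapunovExponent, essSup_congr_ae h2, essSup_const _ (IsProbabilityMeasure.ne_zero _)]

/-- The entropy `h_μ = - ∑ p_λ log p_λ` of the Bernoulli measure `p^ℕ`. -/
def entropy {Λ : Type*} [Fintype Λ] (p : PMF Λ) : ℝ :=
  ∑ l, -(p l).toReal * Real.log (p l).toReal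

/-- `h_μ + γ_1 + ⋯ + γ_i`. -/
def entropySum {Λ : Type*} [Fintype Λ] [MeasurableSpace Λ] {d : ℕ} (p : PMF Λ)
    (A : Λ → GL (Fin d) ℝ) (i : ℕ) : ℝ :=
  entropy p + ∑ j ∈ Finset.range i, lyapunovExponent p A j

/-- `k(μ) = max {0 ≤ i ≤ d : 0 < h_μ + γ_1 + ⋯ + γ_i}`; the set contains `0` as soon as `Λ` has at
least two points of positive weight. -/
def lyapunovIndex {Λ : Type*} [Fintype Λ] [MeasurableSpace Λ] {d : ℕ} (p : PMF Λ)
    (A : Λ → GL (Fin d) ℝ) : ℕ :=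
  sSup {i : ℕ | i ≤ d ∧ 0 < entropySum p A i}

/-- The Lyapunov dimension `D(μ)`. Since exponents are indexed from `0`, `γ_{k+1}` is
`lyapunovExponent p A k`. -/
def lyapunovDim {Λ : Type*} [Fintype Λ] [MeasurableSpace Λ] {d : ℕ} (p : PMF Λ)
    (A : Λ → GL (Fin d) ℝ) : ℝ :=
  if lyapunovIndex p A < d then
    (lyapunovIndex p A : ℝ) -
      entropySum p A (lyapunovIndex p A) / lyapunovExponent p A (lyapunovIndex p A)
  else
    -(d : ℝ) * (entropy p / ∑ j ∈ Finset.range d, lyapunovExponent p A j)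

/-- The affine map `φ_{v,λ}(x) = A_λ x + v_λ`. -/
def affineMap {Λ : Type*} {d : ℕ} (A : Λ → GL (Fin d) ℝ) (v : Λ → EuclideanSpace ℝ (Fin d))
    (l : Λ) (x : EuclideanSpace ℝ (Fin d)) : EuclideanSpace ℝ (Fin d) :=
  toOp (A l) x + v l

/-- The composition `φ_{v,ω 0} ∘ ⋯ ∘ φ_{v,ω (n-1)}`. -/
def prefixMap {Λ : Type*} {d : ℕ} (A : Λ → GL (Fin d) ℝ) (v : Λ → EuclideanSpace ℝ (Fin d))
    (ω : ℕ → Λ) : ℕ → EuclideanSpace ℝ (Fin d) → EuclideanSpace ℝ (Fin d)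
  | 0 => id
  | n + 1 => prefixMap A v ω n ∘ affineMap A v (ω n)

/-- The coding map `π_v(ω) = lim_n φ_{v,ω 0} ∘ ⋯ ∘ φ_{v,ω n}(0)`. -/
def codingMap {Λ : Type*} {d : ℕ} (A : Λ → GL (Fin d) ℝ) (v : Λ → EuclideanSpace ℝ (Fin d))
    (ω : ℕ → Λ) : EuclideanSpace ℝ (Fin d) :=
  limUnder atTop fun n : ℕ => prefixMap A v ω (n + 1) 0

/-- The upper local dimension `limsup_{ε ↓ 0} log θ(B(x, ε)) / log ε` (closed balls), computed in
the extended reals, with `log 0 = -∞`, so that it is `+∞` outside the support of `θ`. -/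
def upperLocalDim {d : ℕ} (θ : Measure (EuclideanSpace ℝ (Fin d)))
    (x : EuclideanSpace ℝ (Fin d)) : EReal :=
  limsup (fun ε : ℝ => ENNReal.log (θ (Metric.closedBall x ε)) / (Real.log ε : EReal)) (𝓝[>] 0)

end SelfAffine

end

/-! The proof is a covering count followed by Borel–Cantelli; no separation of the pieces is needed.
Typically, the first `n` symbols of `ω` form one of at most `e^{n(h+δ)}` words, and the `i`-th
singular value of their product is at most `e^{n(γ_i+δ)}`. The image of such a cylinder lies in an
affine image of a fixed ball. Cutting that ball along the singular directions makes the images of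
the cells smaller than `e^{nL}`, with `L = γ_{k+1}+δ`. Only the first `k` directions need cutting,
about `e^{n(γ_i-γ_{k+1})}` times each (`exists_code`).

A piece containing a point whose `e^{nL}`-ball has measure below `e^{-nS}` has measure below
`e^{-nS}` itself. If `S` exceeds the exponential rate of the number of pieces, the exceptional sets
are summable, so almost every point has local dimension at most `S / -L`
(`ae_upperLocalDim_codingMap_le`). Letting `δ → 0` gives `k - (h+γ_1+⋯+γ_k)/γ_{k+1}` for every `k <
d`. When the index is `d`, the trivial bound `d` suffices, because `D(μ) ≥ d`. -/

namespace SelfAffine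

/-! ### Singular values and operator norms of products -/

theorem toOp_mul {d : ℕ} (M N : GL (Fin d) ℝ) : toOp (M * N) = toOp M * toOp N := by
  simp [toOp]

theorem toOp_one {d : ℕ} : toOp (1 : GL (Fin d) ℝ) = 1 := by
  simp [toOp]

theorem toOp_inv_apply {d : ℕ} (M : GL (Fin d) ℝ) (x : EuclideanSpace ℝ (Fin d)) :
    toOp M⁻¹ (toOp M x) = x := by
  rw [← mul_apply_eq_comp, ← toOp_mul, inv_mul_cancel, toOp_one]
  rfl

/-- There is an orthonormal basis whose images under `M` have the singular values as norms. -/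
theorem exists_orthonormalBasis_norm_eq_singularValue {d : ℕ} (M : GL (Fin d) ℝ) :
    ∃ b : OrthonormalBasis (Fin d) ℝ (EuclideanSpace ℝ (Fin d)),
      ∀ i : Fin d, ‖toOp M (b i)‖ = singularValue M i := by
  have hn : Module.finrank ℝ (EuclideanSpace ℝ (Fin d)) = d := by simp
  set T : EuclideanSpace ℝ (Fin d) →ₗ[ℝ] EuclideanSpace ℝ (Fin d) := ↑(toOp M) with hT
  -- The right singular vectors are the eigenvectors of `T* T`.
  refine ⟨T.isSymmetric_adjoint_comp_self.eigenvectorBasis hn, fun i => ?_⟩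
  set b := T.isSymmetric_adjoint_comp_self.eigenvectorBasis hn
  have h1 : ‖T (b i)‖ ^ 2 = T.singularValues i ^ 2 := by
    rw [T.sq_singularValues_fin hn, ← real_inner_self_eq_norm_sq, ← LinearMap.adjoint_inner_left]
    have := T.isSymmetric_adjoint_comp_self.apply_eigenvectorBasis hn i
    rw [LinearMap.comp_apply] at this
    rw [this, inner_smul_left, real_inner_self_eq_norm_sq]
    simp
  exact (sq_eq_sq₀ (norm_nonneg _) (T.singularValues_nonneg i)).1 h1

theorem singularValue_le_norm {d : ℕ} (M : GL (Fin d) ℝ) {i : ℕ} (hi : i < d) :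
    singularValue M i ≤ ‖toOp M‖ := by
  obtain ⟨b, hb⟩ := exists_orthonormalBasis_norm_eq_singularValue M
  rw [← hb ⟨i, hi⟩]
  simpa using (toOp M).le_opNorm (b ⟨i, hi⟩)

theorem one_le_norm_inv_mul_singularValue {d : ℕ} (M : GL (Fin d) ℝ) {i : ℕ} (hi : i < d) :
    1 ≤ ‖toOp M⁻¹‖ * singularValue M i := by
  obtain ⟨b, hb⟩ := exists_orthonormalBasis_norm_eq_singularValue M
  rw [← hb ⟨i, hi⟩]
  have := (toOp M⁻¹).le_opNorm (toOp M (b ⟨i, hi⟩))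
  rwa [toOp_inv_apply, b.norm_eq_one] at this

theorem prefixProd_succ {Λ : Type*} {d : ℕ} (A : Λ → GL (Fin d) ℝ) (ω : ℕ → Λ) (n : ℕ) :
    prefixProd A ω (n + 1) = prefixProd A ω n * A (ω n) := by
  simp [prefixProd, List.range_succ]

/-- Only an inequality, since the norm is `0` when `d = 0`. -/
theorem norm_toOp_one_le {d : ℕ} : ‖toOp (1 : GL (Fin d) ℝ)‖ ≤ 1 := by
  rw [toOp_one]
  exact ContinuousLinearMap.norm_id_le

theorem norm_toOp_prefixProd_le {Λ : Type*} {d : ℕ} {A : Λ → GL (Fin d) ℝ} {q : ℝ}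
    (hq : ∀ l, ‖toOp (A l)‖ ≤ q) (ω : ℕ → Λ) (n : ℕ) : ‖toOp (prefixProd A ω n)‖ ≤ q ^ n := by
  induction n with
  | zero => simpa [prefixProd] using norm_toOp_one_le
  | succ n ih =>
    rw [prefixProd_succ, toOp_mul, pow_succ]
    exact (norm_mul_le _ _).trans
      (mul_le_mul ih (hq _) (norm_nonneg _) ((norm_nonneg _).trans ih))

theorem norm_toOp_prefixProd_inv_le {Λ : Type*} {d : ℕ} {A : Λ → GL (Fin d) ℝ} {q : ℝ}
    (hq : ∀ l, ‖toOp (A l)⁻¹‖ ≤ q) (ω : ℕ → Λ) (n : ℕ) :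
    ‖toOp (prefixProd A ω n)⁻¹‖ ≤ q ^ n := by
  induction n with
  | zero => simpa [prefixProd] using norm_toOp_one_le
  | succ n ih =>
    rw [prefixProd_succ, mul_inv_rev, toOp_mul, pow_succ']
    exact (norm_mul_le _ _).trans
      (mul_le_mul (hq _) ih (norm_nonneg _) ((norm_nonneg _).trans (hq (ω n))))

theorem exists_contraction_bound {Λ : Type*} [Finite Λ] {d : ℕ} {A : Λ → GL (Fin d) ℝ}
    (hA : ∀ l, ‖toOp (A l)‖ < 1) : ∃ q : ℝ, 0 < q ∧ q < 1 ∧ ∀ l, ‖toOp (A l)‖ ≤ q := by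
  cases isEmpty_or_nonempty Λ with
  | inl h => exact ⟨1 / 2, by norm_num, by norm_num, fun l => isEmptyElim l⟩
  | inr h =>
    obtain ⟨l, hl⟩ := Finite.exists_max fun l => ‖toOp (A l)‖
    exact ⟨max ‖toOp (A l)‖ (1 / 2), by positivity, max_lt (hA l) (by norm_num),
      fun m => (hl m).trans (le_max_left _ _)⟩

theorem exists_inv_bound {Λ : Type*} [Finite Λ] {d : ℕ} (A : Λ → GL (Fin d) ℝ) :
    ∃ q : ℝ, 1 ≤ q ∧ ∀ l, ‖toOp (A l)⁻¹‖ ≤ q := by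
  cases isEmpty_or_nonempty Λ with
  | inl h => exact ⟨1, le_rfl, fun l => isEmptyElim l⟩
  | inr h =>
    obtain ⟨l, hl⟩ := Finite.exists_max fun l => ‖toOp (A l)⁻¹‖
    exact ⟨max ‖toOp (A l)⁻¹‖ 1, le_max_right _ _, fun m => (hl m).trans (le_max_left _ _)⟩

/-- These uniform bounds keep the real-valued `limsup` and `essSup` from taking default values. The
negative upper bound excludes `n = 0`, where the exponent is `0` because `1 / 0 = 0`. -/
theorem exists_finiteExponent_bounds {Λ : Type*} [Finite Λ] {d : ℕ} {A : Λ → GL (Fin d) ℝ}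
    (hA : ∀ l, ‖toOp (A l)‖ < 1) :
    ∃ a b : ℝ, b < 0 ∧ (∀ i < d, ∀ ω n, a ≤ finiteExponent A i ω n) ∧
      ∀ i < d, ∀ ω n, 0 < n → finiteExponent A i ω n ≤ b := by
  obtain ⟨q, hq0, hq1, hq⟩ := exists_contraction_bound hA
  obtain ⟨Q, hQ1, hQ⟩ := exists_inv_bound A
  have hQ0 : 0 < Q := by linarith
  have hlow : ∀ i < d, ∀ ω n, 1 ≤ Q ^ n * singularValue (prefixProd A ω n) i := by
    intro i hi ω n
    refine (one_le_norm_inv_mul_singularValue (prefixProd A ω n) hi).trans ?_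
    exact mul_le_mul_of_nonneg_right (norm_toOp_prefixProd_inv_le hQ ω n)
      (LinearMap.singularValues_nonneg _ _)
  have hpos : ∀ i < d, ∀ ω n, 0 < singularValue (prefixProd A ω n) i := fun i hi ω n =>
    pos_of_mul_pos_right (one_pos.trans_le (hlow i hi ω n)) (by positivity)
  refine ⟨-Real.log Q, Real.log q, Real.log_neg hq0 hq1, fun i hi ω n => ?_, fun i hi ω n hn => ?_⟩
  · rcases Nat.eq_zero_or_pos n with rfl | hn
    · simpa [finiteExponent] using Real.log_nonneg hQ1
    · have hn' : (0 : ℝ) < n := Nat.cast_pos.2 hn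
      have h := Real.log_le_log one_pos (hlow i hi ω n)
      rw [Real.log_one, Real.log_mul (by positivity) (hpos i hi ω n).ne', Real.log_pow] at h
      rw [finiteExponent, one_div_mul_eq_div, le_div_iff₀ hn']
      linarith
  · have hn' : (0 : ℝ) < n := Nat.cast_pos.2 hn
    have h := Real.log_le_log (hpos i hi ω n)
      ((singularValue_le_norm _ hi).trans (norm_toOp_prefixProd_le hq ω n))
    rw [Real.log_pow] at h
    rw [finiteExponent, one_div_mul_eq_div, div_le_iff₀ hn']
    linarith

instance {Λ : Type*} [MeasurableSpace Λ] (p : PMF Λ) : IsProbabilityMeasure (bernoulli p) := by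
  unfold bernoulli; infer_instance

/-! ### Lyapunov exponents -/

section Exponents

variable {Λ : Type*} [Finite Λ] {d : ℕ} {A : Λ → GL (Fin d) ℝ}

theorem isBoundedUnder_le_finiteExponent (hA : ∀ l, ‖toOp (A l)‖ < 1) {i : ℕ} (hi : i < d)
    (ω : ℕ → Λ) : IsBoundedUnder (· ≤ ·) atTop (finiteExponent A i ω) := by
  obtain ⟨a, b, -, -, hb⟩ := exists_finiteExponent_bounds hA
  exact isBoundedUnder_of_eventually_le ((eventually_gt_atTop 0).mono fun n hn => hb i hi ω n hn)

theorem isCoboundedUnder_le_finiteExponent (hA : ∀ l, ‖toOp (A l)‖ < 1) {i : ℕ} (hi : i < d)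
    (ω : ℕ → Λ) : IsCoboundedUnder (· ≤ ·) atTop (finiteExponent A i ω) := by
  obtain ⟨a, b, -, ha, -⟩ := exists_finiteExponent_bounds hA
  exact IsBoundedUnder.isCoboundedUnder_le (isBoundedUnder_of ⟨a, fun n => ha i hi ω n⟩)

theorem exists_limsup_finiteExponent_bounds (hA : ∀ l, ‖toOp (A l)‖ < 1) :
    ∃ a b : ℝ, b < 0 ∧ ∀ i < d, ∀ ω, limsup (finiteExponent A i ω) atTop ∈ Set.Icc a b := by
  obtain ⟨a, b, hb0, ha, hb⟩ := exists_finiteExponent_bounds hA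
  refine ⟨a, b, hb0, fun i hi ω => ⟨?_, ?_⟩⟩
  · exact le_limsup_of_frequently_le (Frequently.of_forall fun n => ha i hi ω n)
      (isBoundedUnder_le_finiteExponent hA hi ω)
  · exact limsup_le_of_le (isCoboundedUnder_le_finiteExponent hA hi ω)
      ((eventually_gt_atTop 0).mono fun n hn => hb i hi ω n hn)

variable [MeasurableSpace Λ]

theorem isBoundedUnder_le_limsup_finiteExponent (p : PMF Λ) (hA : ∀ l, ‖toOp (A l)‖ < 1)
    {i : ℕ} (hi : i < d) :
    IsBoundedUnder (· ≤ ·) (ae (bernoulli p))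
      fun ω => limsup (finiteExponent A i ω) atTop := by
  obtain ⟨a, b, -, h⟩ := exists_limsup_finiteExponent_bounds hA
  exact isBoundedUnder_of ⟨b, fun ω => (h i hi ω).2⟩

theorem isCoboundedUnder_le_limsup_finiteExponent (p : PMF Λ) (hA : ∀ l, ‖toOp (A l)‖ < 1)
    {i : ℕ} (hi : i < d) :
    IsCoboundedUnder (· ≤ ·) (ae (bernoulli p))
      fun ω => limsup (finiteExponent A i ω) atTop := by
  obtain ⟨a, b, -, h⟩ := exists_limsup_finiteExponent_bounds hA
  exact IsBoundedUnder.isCoboundedUnder_le (isBoundedUnder_of ⟨a, fun ω => (h i hi ω).1⟩)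

theorem lyapunovExponent_neg (p : PMF Λ) (hA : ∀ l, ‖toOp (A l)‖ < 1) {i : ℕ} (hi : i < d) :
    lyapunovExponent p A i < 0 := by
  obtain ⟨a, b, hb, h⟩ := exists_limsup_finiteExponent_bounds hA
  exact (essSup_le_of_ae_le b (ae_of_all _ fun ω => (h i hi ω).2)
    (isCoboundedUnder_le_limsup_finiteExponent p hA hi)).trans_lt hb

theorem lyapunovExponent_antitone (p : PMF Λ) (hA : ∀ l, ‖toOp (A l)‖ < 1) {i j : ℕ}
    (hij : i ≤ j) (hj : j < d) : lyapunovExponent p A j ≤ lyapunovExponent p A i := by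
  refine essSup_mono_ae (ae_of_all _ fun ω => ?_)
    (isCoboundedUnder_le_limsup_finiteExponent p hA hj)
    (isBoundedUnder_le_limsup_finiteExponent p hA (hij.trans_lt hj))
  refine limsup_le_limsup (Eventually.of_forall fun n => ?_)
    (isCoboundedUnder_le_finiteExponent hA hj ω)
    (isBoundedUnder_le_finiteExponent hA (hij.trans_lt hj) ω)
  refine mul_le_mul_of_nonneg_left (Real.log_le_log ?_ ?_) (by positivity)
  · have h := one_le_norm_inv_mul_singularValue (prefixProd A ω n) hj
    exact pos_of_mul_pos_right (one_pos.trans_le h) (norm_nonneg _)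
  · exact LinearMap.singularValues_antitone _ hij

/-- Only the upper bound on the growth is needed. It follows directly from the definition of the
exponent as an essential supremum of upper limits, without an ergodic theorem. -/
theorem ae_eventually_singularValue_le (p : PMF Λ) (hA : ∀ l, ‖toOp (A l)‖ < 1) {δ : ℝ}
    (hδ : 0 < δ) :
    ∀ᵐ ω ∂bernoulli p, ∀ᶠ n : ℕ in atTop, ∀ i : Fin d,
      singularValue (prefixProd A ω n) i ≤ Real.exp (n * (lyapunovExponent p A i + δ)) := by
  have h : ∀ i : Fin d, ∀ᵐ ω ∂bernoulli p,
      limsup (finiteExponent A i ω) atTop ≤ lyapunovExponent p A i := fun i =>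
    ae_le_essSup (isBoundedUnder_le_limsup_finiteExponent p hA i.2)
  filter_upwards [ae_all_iff.2 h] with ω hω
  refine eventually_all.2 fun i => ?_
  have h1 := eventually_lt_of_limsup_lt ((hω i).trans_lt (lt_add_of_pos_right _ hδ))
    (isBoundedUnder_le_finiteExponent hA i.2 ω)
  filter_upwards [h1, eventually_gt_atTop 0] with n hn hn0
  have hn' : (0 : ℝ) < n := Nat.cast_pos.2 hn0
  rw [finiteExponent, one_div_mul_eq_div, div_lt_iff₀ hn'] at hn
  refine (Real.le_exp_log _).trans (Real.exp_le_exp.2 ?_)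
  linarith

end Exponents

/-! ### The coding map -/

section Coding

variable {Λ : Type*} {d : ℕ} {A : Λ → GL (Fin d) ℝ} {v : Λ → EuclideanSpace ℝ (Fin d)}

theorem prefixMap_apply (ω : ℕ → Λ) (n : ℕ) (y : EuclideanSpace ℝ (Fin d)) :
    prefixMap A v ω n y = toOp (prefixProd A ω n) y + prefixMap A v ω n 0 := by
  induction n generalizing y with
  | zero => simp [prefixMap, prefixProd, toOp_one]
  | succ n ih =>
    simp only [prefixMap, Function.comp_apply]
    rw [ih (affineMap A v (ω n) y), ih (affineMap A v (ω n) 0), prefixProd_succ, toOp_mul]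
    simp only [affineMap, map_add, map_zero, mul_apply_eq_comp, zero_add]
    abel

theorem prefixMap_add (ω : ℕ → Λ) (n m : ℕ) (y : EuclideanSpace ℝ (Fin d)) :
    prefixMap A v ω (n + m) y = prefixMap A v ω n (prefixMap A v (fun j => ω (n + j)) m y) := by
  induction m generalizing y with
  | zero => rfl
  | succ m ih => exact ih _

theorem prefixMap_congr {ω ω' : ℕ → Λ} {n : ℕ} (h : ∀ j < n, ω j = ω' j) :
    prefixMap A v ω n = prefixMap A v ω' n := by
  induction n with
  | zero => rfl
  | succ n ih =>
    simp only [prefixMap]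
    rw [ih fun j hj => h j (hj.trans n.lt_succ_self), h n n.lt_succ_self]

theorem prefixProd_congr {ω ω' : ℕ → Λ} {n : ℕ} (h : ∀ j < n, ω j = ω' j) :
    prefixProd A ω n = prefixProd A ω' n := by
  induction n with
  | zero => rfl
  | succ n ih =>
    rw [prefixProd_succ, prefixProd_succ, ih fun j hj => h j (hj.trans n.lt_succ_self),
      h n n.lt_succ_self]

variable [Finite Λ]

theorem exists_dist_prefixMap_le (hA : ∀ l, ‖toOp (A l)‖ < 1) :
    ∃ q C : ℝ, q < 1 ∧
      ∀ ω n, dist (prefixMap A v ω n 0) (prefixMap A v ω (n + 1) 0) ≤ C * q ^ n := by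
  obtain ⟨q, hq0, hq1, hq⟩ := exists_contraction_bound hA
  obtain ⟨C, hC⟩ := (Set.finite_range fun l => ‖v l‖).bddAbove
  refine ⟨q, C, hq1, fun ω n => ?_⟩
  have h : prefixMap A v ω (n + 1) 0 = toOp (prefixProd A ω n) (v (ω n)) + prefixMap A v ω n 0 := by
    rw [← prefixMap_apply]
    simp [prefixMap, affineMap]
  rw [h, dist_eq_norm, sub_add_cancel_right, norm_neg, mul_comm]
  refine ((toOp _).le_opNorm _).trans ?_
  exact mul_le_mul (norm_toOp_prefixProd_le hq ω n) (hC ⟨ω n, rfl⟩) (norm_nonneg _) (by positivity)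

theorem tendsto_prefixMap_codingMap (hA : ∀ l, ‖toOp (A l)‖ < 1) (ω : ℕ → Λ) :
    Tendsto (fun n => prefixMap A v ω n 0) atTop (𝓝 (codingMap A v ω)) := by
  obtain ⟨q, C, hq, h⟩ := exists_dist_prefixMap_le (v := v) hA
  have hc := cauchySeq_of_le_geometric q C hq (h ω)
  obtain ⟨x, hx⟩ := cauchySeq_tendsto_of_complete hc
  rw [← tendsto_add_atTop_iff_nat 1]
  exact tendsto_nhds_limUnder ⟨x, (tendsto_add_atTop_iff_nat 1).2 hx⟩

theorem exists_norm_codingMap_le (v : Λ → EuclideanSpace ℝ (Fin d))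
    (hA : ∀ l, ‖toOp (A l)‖ < 1) : ∃ R : ℝ, 0 ≤ R ∧ ∀ ω, ‖codingMap A v ω‖ ≤ R := by
  obtain ⟨q, C, hq, h⟩ := exists_dist_prefixMap_le (v := v) hA
  refine ⟨max (C / (1 - q)) 0, le_max_right _ _, fun ω => le_max_of_le_left ?_⟩
  have := dist_le_of_le_geometric_of_tendsto₀ q C hq (h ω) (tendsto_prefixMap_codingMap hA ω)
  rwa [prefixMap, id, dist_zero_left] at this

theorem codingMap_eq (hA : ∀ l, ‖toOp (A l)‖ < 1) (ω : ℕ → Λ) (n : ℕ) :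
    codingMap A v ω =
      toOp (prefixProd A ω n) (codingMap A v fun j => ω (n + j)) + prefixMap A v ω n 0 := by
  have h1 := (tendsto_add_atTop_iff_nat n).2 (tendsto_prefixMap_codingMap (v := v) hA ω)
  refine tendsto_nhds_unique h1 ?_
  simp_rw [add_comm _ n, prefixMap_add ω n]
  simp_rw [prefixMap_apply ω n (prefixMap A v _ _ 0)]
  exact (((toOp _).continuous.tendsto _).comp (tendsto_prefixMap_codingMap hA _)).add_const _

variable [MeasurableSpace Λ] [DiscreteMeasurableSpace Λ]

/-- Measurability is joint in `ω` and the point because, in the induction, the inner point itself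
depends on `ω`. -/
theorem measurable_prefixMap (n : ℕ) :
    Measurable fun z : (ℕ → Λ) × EuclideanSpace ℝ (Fin d) => prefixMap A v z.1 n z.2 := by
  induction n with
  | zero => exact measurable_snd
  | succ n ih =>
    have h : Measurable fun z : Λ × EuclideanSpace ℝ (Fin d) => affineMap A v z.1 z.2 := by
      refine measurable_from_prod_countable_right fun l => ?_
      change Measurable fun y => toOp (A l) y + v l
      fun_prop
    have hg : Measurable fun z : (ℕ → Λ) × EuclideanSpace ℝ (Fin d) => (z.1 n, z.2) := by
      fun_prop
    have h2 : Measurable fun z : (ℕ → Λ) × EuclideanSpace ℝ (Fin d) =>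
        affineMap A v (z.1 n) z.2 := by
      have h' := h.comp hg
      exact h'
    have h3 : Measurable fun z : (ℕ → Λ) × EuclideanSpace ℝ (Fin d) =>
        (z.1, affineMap A v (z.1 n) z.2) := Measurable.prodMk measurable_fst h2
    exact ih.comp h3

theorem measurable_codingMap (hA : ∀ l, ‖toOp (A l)‖ < 1) :
    Measurable (codingMap A v) := by
  refine measurable_of_tendsto_metrizable
    (f := fun n ω => prefixMap A v ω n 0) (fun n => ?_)
    (tendsto_pi_nhds.2 fun ω => tendsto_prefixMap_codingMap hA ω)
  exact (measurable_prefixMap n).comp (measurable_id.prodMk measurable_const)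

end Coding

/-! ### Covering and Borel–Cantelli -/

/-- If a set `G` is split into at most `N` pieces whose images have diameter at most `r`, the points
of `G` around whose image the closed `r`-ball has measure less than `c` have measure at most
`N * c`. -/
theorem measure_ball_lt_le {Ω X ι : Type*} [MeasurableSpace Ω] [PseudoMetricSpace X]
    [MeasurableSpace X] [OpensMeasurableSpace X] (μ : Measure Ω) {π : Ω → X} (hπ : Measurable π)
    {G : Set Ω} (f : Ω → ι) (t : Finset ι) (hf : ∀ ω ∈ G, f ω ∈ t) {r : ℝ}
    (hr : ∀ ω ∈ G, ∀ ω' ∈ G, f ω = f ω' → dist (π ω) (π ω') ≤ r) (c : ENNReal) :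
    μ {ω ∈ G | μ.map π (Metric.closedBall (π ω) r) < c} ≤ t.card * c := by
  set B := {ω ∈ G | μ.map π (Metric.closedBall (π ω) r) < c} with hB
  have hsub : B ⊆ ⋃ i ∈ t, {ω ∈ B | f ω = i} := by
    intro ω hω
    simp only [Set.mem_iUnion]
    exact ⟨f ω, hf ω hω.1, hω, rfl⟩
  refine (measure_mono hsub).trans ((measure_biUnion_finset_le _ _).trans ?_)
  rw [← nsmul_eq_mul]
  refine Finset.sum_le_card_nsmul _ _ _ fun i _ => ?_
  -- A nonempty piece of the bad set lies over the ball around any of its own points, and that ball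
  -- has measure below `c`.
  rcases Set.eq_empty_or_nonempty {ω ∈ B | f ω = i} with h | ⟨ω, hω, hi⟩
  · simp [h]
  · have h1 : {ω ∈ B | f ω = i} ⊆ π ⁻¹' Metric.closedBall (π ω) r := fun ω' hω' =>
      hr ω' hω'.1.1 ω hω.1 (hω'.2.trans hi.symm)
    refine (measure_mono h1).trans ?_
    rw [← Measure.map_apply hπ Metric.isClosed_closedBall.measurableSet]
    exact hω.2.le

theorem ae_eventually_le_measure_ball {Ω X : Type*} [MeasurableSpace Ω] [PseudoMetricSpace X]
    [MeasurableSpace X] [OpensMeasurableSpace X] (μ : Measure Ω) {π : Ω → X} (hπ : Measurable π)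
    {G : ℕ → Set Ω} (hG : ∀ᵐ ω ∂μ, ∀ᶠ n in atTop, ω ∈ G n) {r : ℕ → ℝ} {c : ℕ → ENNReal}
    {b : ℕ → ENNReal} (hb : ∑' n, b n ≠ ⊤)
    (h : ∀ n, ∃ ι : Type*, ∃ (f : Ω → ι) (t : Finset ι), (∀ ω ∈ G n, f ω ∈ t) ∧
      (∀ ω ∈ G n, ∀ ω' ∈ G n, f ω = f ω' → dist (π ω) (π ω') ≤ r n) ∧ t.card * c n ≤ b n) :
    ∀ᵐ ω ∂μ, ∀ᶠ n in atTop, c n ≤ μ.map π (Metric.closedBall (π ω) (r n)) := by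
  have h1 : ∑' n, μ {ω ∈ G n | μ.map π (Metric.closedBall (π ω) (r n)) < c n} ≠ ⊤ := by
    refine ne_top_of_le_ne_top hb (ENNReal.tsum_le_tsum fun n => ?_)
    obtain ⟨ι, f, t, hf, hr, hc⟩ := h n
    exact (measure_ball_lt_le μ hπ f t hf hr (c n)).trans hc
  filter_upwards [hG, ae_eventually_notMem h1] with ω hω1 hω2
  filter_upwards [hω1, hω2] with n hn1 hn2
  by_contra hlt
  exact hn2 ⟨hn1, not_le.1 hlt⟩

theorem abs_sub_mul_le_of_floor_eq {s x y : ℝ} (h : ⌊s * x⌋ = ⌊s * y⌋) (hs : 0 < s) :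
    |x - y| ≤ 1 / s := by
  have := Int.abs_sub_lt_one_of_floor_eq_floor h
  rw [← mul_sub, abs_mul, abs_of_pos hs] at this
  rw [le_div_iff₀ hs]
  linarith

theorem card_Icc_floor_le {x : ℝ} (hx : 0 ≤ x) :
    ((Finset.Icc ⌊-x⌋ ⌊x⌋).card : ℝ) ≤ 2 * x + 2 := by
  have h1 : ⌊-x⌋ ≤ ⌊x⌋ := Int.floor_le_floor (by linarith)
  have h2 : ((Finset.Icc ⌊-x⌋ ⌊x⌋).card : ℝ) = ⌊x⌋ + 1 - ⌊-x⌋ := by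
    rw [Int.card_Icc]
    have : ((⌊x⌋ + 1 - ⌊-x⌋).toNat : ℤ) = ⌊x⌋ + 1 - ⌊-x⌋ := Int.toNat_of_nonneg (by omega)
    exact_mod_cast congrArg (Int.cast : ℤ → ℝ) this
  have h3 := Int.floor_le x
  have h4 := Int.lt_floor_add_one (-x)
  rw [h2]
  linarith

/-- The image under `M` of a cell of side lengths `1 / s i` along singular directions. -/
theorem norm_toOp_le_sum {d : ℕ} (M : GL (Fin d) ℝ)
    (b : OrthonormalBasis (Fin d) ℝ (EuclideanSpace ℝ (Fin d)))
    (hb : ∀ i : Fin d, ‖toOp M (b i)‖ = singularValue M i) (x : EuclideanSpace ℝ (Fin d)) :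
    ‖toOp M x‖ ≤ ∑ i : Fin d, |inner ℝ (b i) x| * singularValue M i := by
  conv_lhs => rw [← b.sum_repr' x]
  rw [map_sum]
  refine (norm_sum_le _ _).trans (Finset.sum_le_sum fun i _ => ?_)
  rw [map_smul, norm_smul, hb, Real.norm_eq_abs]

/-- The points of the attractor whose first `n` symbols form one of finitely many words, and for
which the singular values of the corresponding product are bounded by `a`, are covered by few sets
of diameter at most `r`. -/
theorem exists_code {Λ : Type*} [Finite Λ] {d : ℕ} {A : Λ → GL (Fin d) ℝ}
    {v : Λ → EuclideanSpace ℝ (Fin d)} (hA : ∀ l, ‖toOp (A l)‖ < 1) {R : ℝ}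
    (hR0 : 0 ≤ R) (hR : ∀ ω, ‖codingMap A v ω‖ ≤ R) (n : ℕ) (W : Finset (Fin n → Λ)) {G : Set (ℕ → Λ)}
    (hW : ∀ ω ∈ G, (fun j : Fin n => ω j) ∈ W) {a s : Fin d → ℝ} {r : ℝ}
    (ha : ∀ ω ∈ G, ∀ i : Fin d, singularValue (prefixProd A ω n) i ≤ a i)
    (hs : ∀ i, 0 < s i) (hr : ∀ i, d * a i ≤ r * s i) (hr0 : 0 ≤ r) :
    ∃ (f : (ℕ → Λ) → (Fin n → Λ) × (Fin d → ℤ)) (t : Finset ((Fin n → Λ) × (Fin d → ℤ))),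
      (∀ ω ∈ G, f ω ∈ t) ∧
      (∀ ω ∈ G, ∀ ω' ∈ G, f ω = f ω' → dist (codingMap A v ω) (codingMap A v ω') ≤ r) ∧
      (t.card : ℝ) ≤ W.card * ∏ i, (2 * (R * s i) + 2) := by
  -- The singular basis is chosen once per matrix, so equal words give the same basis.
  choose b hb using fun M : GL (Fin d) ℝ => exists_orthonormalBasis_norm_eq_singularValue M
  let y : (ℕ → Λ) → EuclideanSpace ℝ (Fin d) := fun ω => codingMap A v fun j => ω (n + j)
  -- The code records the word and the grid cell of the tail `y ω`, with side `1 / s i` in the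
  -- `i`-th singular direction.
  refine ⟨fun ω => (fun j : Fin n => ω j,
      fun i => ⌊s i * inner ℝ (b (prefixProd A ω n) i) (y ω)⌋),
    W ×ˢ Fintype.piFinset fun i => Finset.Icc ⌊-(R * s i)⌋ ⌊R * s i⌋, ?_, ?_, ?_⟩
  · intro ω hω
    refine Finset.mem_product.2 ⟨hW ω hω, Fintype.mem_piFinset.2 fun i => ?_⟩
    have h : |inner ℝ (b (prefixProd A ω n) i) (y ω)| ≤ R := by
      refine (abs_real_inner_le_norm _ _).trans ?_
      rw [OrthonormalBasis.norm_eq_one, one_mul]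
      exact hR _
    have h' := abs_le.1 h
    refine Finset.mem_Icc.2 ⟨Int.floor_le_floor ?_, Int.floor_le_floor ?_⟩
    · nlinarith [hs i]
    · nlinarith [hs i]
  · intro ω hω ω' _ hff
    obtain ⟨h1, h2⟩ := Prod.ext_iff.1 hff
    have hw : ∀ j < n, ω j = ω' j := fun j hj => congrFun h1 ⟨j, hj⟩
    have hP := prefixProd_congr (A := A) hw
    have hM := prefixMap_congr (A := A) (v := v) hw
    rw [codingMap_eq hA ω n, codingMap_eq hA ω' n, ← hP, ← hM, dist_add_right, dist_eq_norm,
      ← map_sub]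
    refine (norm_toOp_le_sum _ _ (hb _) _).trans ?_
    -- Each of the `d` directions may contribute `r / d`, whence the factor `d` in `hr`.
    have hterm : ∀ i : Fin d, |inner ℝ (b (prefixProd A ω n) i) (y ω - y ω')| *
        singularValue (prefixProd A ω n) i ≤ r / d := by
      intro i
      have hd : (0 : ℝ) < d := Nat.cast_pos.2 i.pos
      have h3 := congrFun h2 i
      simp only [← hP] at h3
      have h4 := abs_sub_mul_le_of_floor_eq h3 (hs i)
      rw [← inner_sub_right] at h4
      refine (mul_le_mul h4 (ha ω hω i) (LinearMap.singularValues_nonneg _ _)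
        (by have := hs i; positivity)).trans ?_
      rw [one_div_mul_eq_div, div_le_div_iff₀ (hs i) hd, mul_comm]
      exact hr i
    refine (Finset.sum_le_sum fun i _ => hterm i).trans ?_
    rcases Nat.eq_zero_or_pos d with h0 | h0
    · subst h0; simpa using hr0
    · have hd : (d : ℝ) ≠ 0 := by positivity
      simp [mul_div_cancel₀, hd]
  · rw [Finset.card_product, Fintype.card_piFinset]
    push_cast
    refine mul_le_mul_of_nonneg_left (Finset.prod_le_prod (fun _ _ => by positivity) fun i _ => ?_)
      (by positivity)
    exact card_Icc_floor_le (mul_nonneg hR0 (hs i).le)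

/-! ### Counting typical words -/

section Words

variable {Λ : Type*} [Fintype Λ]

theorem entropy_nonneg (p : PMF Λ) : 0 ≤ entropy p := by
  refine Finset.sum_nonneg fun l _ => ?_
  have h1 : (p l).toReal ≤ 1 :=
    ENNReal.toReal_le_of_le_ofReal zero_le_one (by simpa using p.coe_le_one l)
  have := Real.log_nonpos ENNReal.toReal_nonneg h1
  have h0 : 0 ≤ (p l).toReal := ENNReal.toReal_nonneg
  nlinarith

theorem sum_toReal_eq_one (p : PMF Λ) : ∑ l, (p l).toReal = 1 := by
  rw [← ENNReal.toReal_sum fun l _ => p.apply_ne_top l, ← tsum_fintype (L := .unconditional Λ), p.tsum_coe,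
    ENNReal.toReal_one]

/-- The words of length `n` of probability at least `e^{-n H}`. -/
noncomputable def likelyWords (p : PMF Λ) (H : ℝ) (n : ℕ) : Finset (Fin n → Λ) :=
  {w | Real.exp (-(n * H)) ≤ ∏ j, (p (w j)).toReal}

/-- The probabilities of all words of length `n` add up to `1`. -/
theorem card_likelyWords_le (p : PMF Λ) (H : ℝ) (n : ℕ) :
    ((likelyWords p H n).card : ℝ) ≤ Real.exp (n * H) := by
  have h1 : ((likelyWords p H n).card : ℝ) * Real.exp (-(n * H)) ≤ 1 := by
    calc ((likelyWords p H n).card : ℝ) * Real.exp (-(n * H))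
        ≤ ∑ w ∈ likelyWords p H n, ∏ j, (p (w j)).toReal := by
          rw [← nsmul_eq_mul]
          exact Finset.card_nsmul_le_sum _ _ _ fun w hw => (Finset.mem_filter.1 hw).2
      _ ≤ ∑ w : Fin n → Λ, ∏ j, (p (w j)).toReal :=
          Finset.sum_le_sum_of_subset_of_nonneg (Finset.subset_univ _) fun w _ _ =>
            Finset.prod_nonneg fun _ _ => ENNReal.toReal_nonneg
      _ = 1 := by
          have := Finset.prod_univ_sum (fun _ : Fin n => (Finset.univ : Finset Λ))
            (fun _ l => (p l).toReal)
          rw [Fintype.piFinset_univ] at this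
          rw [← this]
          simp [sum_toReal_eq_one]
  rw [Real.exp_neg, ← div_eq_mul_inv, div_le_one (Real.exp_pos _)] at h1
  exact h1

variable [MeasurableSpace Λ] [DiscreteMeasurableSpace Λ]

/-- The strong law of large numbers for `log p_{ω n}`, whose mean is `-h`. -/
theorem ae_eventually_mem_likelyWords (p : PMF Λ) (hp : ∀ l, 0 < p l) {δ : ℝ} (hδ : 0 < δ) :
    ∀ᵐ ω ∂bernoulli p, ∀ᶠ n : ℕ in atTop,
      (fun j : Fin n => ω j) ∈ likelyWords p (entropy p + δ) n := by
  set g : Λ → ℝ := fun l => Real.log (p l).toReal with hg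
  have hgm : Measurable g := measurable_of_countable g
  have hpos : ∀ l, 0 < (p l).toReal := fun l => ENNReal.toReal_pos (hp l).ne' (p.apply_ne_top l)
  have hev : ∀ n : ℕ, (bernoulli p).map (fun ω : ℕ → Λ => ω n) = p.toMeasure := fun n =>
    Measure.infinitePi_map_eval (fun _ : ℕ => p.toMeasure) n
  have hmap : ∀ n : ℕ, (bernoulli p).map (fun ω : ℕ → Λ => g (ω n)) = p.toMeasure.map g := by
    intro n
    rw [← hev n, Measure.map_map hgm (measurable_pi_apply n)]
    rfl
  have hm : ∀ n : ℕ, Measurable fun ω : ℕ → Λ => g (ω n) := fun n =>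
    hgm.comp (measurable_pi_apply n)
  obtain ⟨C, hC⟩ := (Set.finite_range fun l => ‖g l‖).bddAbove
  have hint : Integrable (fun ω : ℕ → Λ => g (ω 0)) (bernoulli p) :=
    Integrable.of_bound (hm 0).aestronglyMeasurable C (ae_of_all _ fun ω => hC ⟨ω 0, rfl⟩)
  have hexp : ∫ ω, g (ω 0) ∂bernoulli p = -entropy p := by
    have h1 := integral_map (μ := bernoulli p) (φ := fun ω : ℕ → Λ => ω 0)
      (measurable_pi_apply 0).aemeasurable (f := g) hgm.aestronglyMeasurable
    rw [← h1, hev 0, PMF.integral_eq_sum, entropy, ← Finset.sum_neg_distrib]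
    exact Finset.sum_congr rfl fun l _ => by simp [hg]
  have hindep : ProbabilityTheory.iIndepFun (fun (n : ℕ) (ω : ℕ → Λ) => g (ω n)) (bernoulli p) :=
    ProbabilityTheory.iIndepFun_infinitePi (P := fun _ : ℕ => p.toMeasure) (X := fun _ => g)
      fun _ => hgm
  have hlln := ProbabilityTheory.strong_law_ae_real (μ := bernoulli p)
    (fun (n : ℕ) (ω : ℕ → Λ) => g (ω n)) hint (fun i j hij => hindep.indepFun hij)
    fun n => ⟨(hm n).aemeasurable, (hm 0).aemeasurable, (hmap n).trans (hmap 0).symm⟩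
  filter_upwards [hlln] with ω hω
  rw [hexp] at hω
  have hlt : -(entropy p + δ) < -entropy p := by linarith
  filter_upwards [hω.eventually_const_lt hlt, eventually_gt_atTop 0] with n hn hn0
  have hn' : (0 : ℝ) < n := Nat.cast_pos.2 hn0
  rw [lt_div_iff₀ hn'] at hn
  refine Finset.mem_filter.2 ⟨Finset.mem_univ _, ?_⟩
  rw [Fin.prod_univ_eq_prod_range (fun j => (p (ω j)).toReal) n,
    ← Real.exp_log (Finset.prod_pos fun j _ => hpos (ω j)),
    Real.log_prod fun j _ => (hpos (ω j)).ne']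
  refine Real.exp_le_exp.2 ?_
  linarith

end Words

/-! ### Local dimension along exponential scales -/

section LocalDim

variable {d : ℕ}

/-- Consecutive scales have logarithms in ratio `(n + 1) / n → 1`, so the radii `e^{nL}` determine
the upper limit over all radii. -/
theorem upperLocalDim_le {θ : Measure (EuclideanSpace ℝ (Fin d))} [IsFiniteMeasure θ]
    {x : EuclideanSpace ℝ (Fin d)} {L S : ℝ} (hL : L < 0) (hS : 0 ≤ S)
    (h : ∀ᶠ n : ℕ in atTop,
      ENNReal.ofReal (Real.exp (-(n * S))) ≤ θ (Metric.closedBall x (Real.exp (n * L)))) :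
    upperLocalDim θ x ≤ ((S / -L : ℝ) : EReal) := by
  refine EReal.le_of_forall_lt_iff_le.1 fun t ht => ?_
  have ht : S / -L < t := by exact_mod_cast ht
  have ht0 : 0 < t := (div_nonneg hS (by linarith)).trans_lt ht
  have hlim : Tendsto (fun n : ℕ => (((n + 1 : ℕ) : ℝ) / n) * (S / -L)) atTop (𝓝 (S / -L)) := by
    have h1 : Tendsto (fun n : ℕ => ((n + 1 : ℕ) : ℝ) / n) atTop (𝓝 1) := by
      have h2 := (tendsto_one_div_atTop_nhds_zero_nat (𝕜 := ℝ)).const_add 1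
      rw [add_zero] at h2
      refine h2.congr' ((eventually_gt_atTop 0).mono fun n hn => ?_)
      have : (n : ℝ) ≠ 0 := by positivity
      push_cast
      field_simp
    simpa using h1.mul_const (S / -L)
  obtain ⟨N, hN⟩ := eventually_atTop.1
    (((tendsto_add_atTop_nat 1).eventually h).and ((hlim.eventually_lt_const ht).and
      (eventually_gt_atTop 0)))
  refine limsup_le_of_le (by isBoundedDefault) ?_
  have hε : ∀ᶠ ε : ℝ in 𝓝[>] 0, ε ∈ Set.Ioo 0 (Real.exp (N * L)) :=
    Ioo_mem_nhdsGT (Real.exp_pos _)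
  filter_upwards [hε] with ε ⟨hε0, hε1⟩
  have hlog : Real.log ε < N * L := (Real.log_lt_iff_lt_exp hε0).2 hε1
  have hq : (N : ℝ) ≤ Real.log ε / L := (le_div_iff_of_neg hL).2 hlog.le
  -- This choice gives `e^{(n+1)L} < ε ≤ e^{nL}`.
  set n := ⌊Real.log ε / L⌋₊ with hn
  have hNn : N ≤ n := Nat.le_floor hq
  have hn1 : Real.log ε ≤ n * L :=
    (le_div_iff_of_neg hL).1 (Nat.floor_le ((Nat.cast_nonneg N).trans hq))
  have hn2 : (n + 1 : ℕ) * L < Real.log ε := by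
    have := (div_lt_iff_of_neg hL).1 (Nat.lt_floor_add_one (Real.log ε / L))
    exact_mod_cast this
  obtain ⟨hb, hr, hn0⟩ := hN n hNn
  have hn0' : (0 : ℝ) < n := Nat.cast_pos.2 hn0
  have hball : ENNReal.ofReal (Real.exp (-((n + 1 : ℕ) * S))) ≤ θ (Metric.closedBall x ε) :=
    hb.trans (measure_mono (Metric.closedBall_subset_closedBall
      ((Real.lt_log_iff_exp_lt hε0).1 hn2).le))
  have hreal : Real.exp (-((n + 1 : ℕ) * S)) ≤ (θ (Metric.closedBall x ε)).toReal :=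
    (ENNReal.ofReal_le_iff_le_toReal (measure_ne_top _ _)).1 hball
  have hpos := (Real.exp_pos _).trans_le hreal
  rw [ENNReal.log_pos_real' hpos, ← EReal.coe_div, EReal.coe_le_coe_iff]
  have hlogε : Real.log ε < 0 := hn1.trans_lt (mul_neg_of_pos_of_neg hn0' hL)
  rw [div_le_iff_of_neg hlogε]
  have h1 : -((n + 1 : ℕ) * S) ≤ Real.log (θ (Metric.closedBall x ε)).toReal :=
    (Real.le_log_iff_exp_le hpos).2 hreal
  refine le_trans ?_ h1
  rw [div_mul_div_comm, div_lt_iff₀ (by nlinarith)] at hr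
  nlinarith

theorem ae_upperLocalDim_le {Ω : Type*} [MeasurableSpace Ω] (μ : Measure Ω) [IsFiniteMeasure μ]
    {π : Ω → EuclideanSpace ℝ (Fin d)} (hπ : Measurable π) {L S : ℝ} (hL : L < 0) (hS : 0 ≤ S)
    (h : ∀ᵐ ω ∂μ, ∀ᶠ n : ℕ in atTop, ENNReal.ofReal (Real.exp (-(n * S))) ≤
      μ.map π (Metric.closedBall (π ω) (Real.exp (n * L)))) :
    ∀ᵐ x ∂μ.map π, upperLocalDim (μ.map π) x ≤ ((S / -L : ℝ) : EReal) := by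
  -- Transferring an almost sure statement from `μ` to its image requires a measurable set; the
  -- measure of a ball is measurable in its centre, being that of a section of a closed set.
  have hmeas : ∀ n : ℕ, Measurable fun x => μ.map π (Metric.closedBall x (Real.exp (n * L))) := by
    intro n
    have hs : MeasurableSet {z : EuclideanSpace ℝ (Fin d) × EuclideanSpace ℝ (Fin d) |
        dist z.2 z.1 ≤ Real.exp (n * L)} :=
      (isClosed_le (continuous_snd.dist continuous_fst) continuous_const).measurableSet
    exact measurable_measure_prodMk_left hs
  have hset : MeasurableSet {x | ∀ᶠ n : ℕ in atTop, ENNReal.ofReal (Real.exp (-(n * S))) ≤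
      μ.map π (Metric.closedBall x (Real.exp (n * L)))} := by
    simp only [eventually_atTop, Set.ofPred_exists, Set.ofPred_forall]
    exact MeasurableSet.iUnion fun N => MeasurableSet.iInter fun n => MeasurableSet.iInter fun _ =>
      measurableSet_le measurable_const (hmeas n)
  filter_upwards [(ae_map_iff hπ.aemeasurable hset).2 h] with x hx
  exact upperLocalDim_le hL hS hx

end LocalDim

/-! ### Exponential rates and the limit `δ → 0` -/

section Rates

variable {Λ : Type*} [Fintype Λ] [MeasurableSpace Λ] [DiscreteMeasurableSpace Λ] {d : ℕ}
  {A : Λ → GL (Fin d) ℝ}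

/-- The covering bound: words of length `m n` are used at scale `e^{n L}`, at most `e^{n H}` of them
are relevant, and their singular values are at most `e^{n (a i)}`. -/
theorem ae_upperLocalDim_codingMap_le (p : PMF Λ) (v : Λ → EuclideanSpace ℝ (Fin d))
    (hA : ∀ l, ‖toOp (A l)‖ < 1) (m : ℕ → ℕ) (W : ∀ n, Finset (Fin (m n) → Λ))
    {H L δ : ℝ} (hH : 0 ≤ H) (hL : L < 0) (hδ : 0 < δ) {a g : Fin d → ℝ} (hg : ∀ i, 0 ≤ g i)
    (hag : ∀ i, a i ≤ L + g i) (hcard : ∀ n, ((W n).card : ℝ) ≤ Real.exp (n * H))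
    (hW : ∀ᵐ ω ∂bernoulli p, ∀ᶠ n : ℕ in atTop, (fun j : Fin (m n) => ω j) ∈ W n)
    (ha : ∀ᵐ ω ∂bernoulli p, ∀ᶠ n : ℕ in atTop, ∀ i : Fin d,
      singularValue (prefixProd A ω (m n)) i ≤ Real.exp (n * a i)) :
    ∀ᵐ x ∂(bernoulli p).map (codingMap A v),
      upperLocalDim ((bernoulli p).map (codingMap A v)) x
        ≤ (((H + ∑ i, g i + δ) / -L : ℝ) : EReal) := by
  obtain ⟨R, hR0, hR⟩ := exists_norm_codingMap_le v hA
  have hS : 0 ≤ H + ∑ i, g i + δ := by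
    have := Finset.sum_nonneg fun i (_ : i ∈ Finset.univ) => hg i
    linarith
  refine ae_upperLocalDim_le (bernoulli p) (measurable_codingMap hA) hL hS ?_
  set C : ℝ := (2 * (R * d) + 2) ^ d with hC
  have hC0 : 0 ≤ C := by positivity
  let G : ℕ → Set (ℕ → Λ) := fun n => {ω | (fun j : Fin (m n) => ω j) ∈ W n ∧
    ∀ i : Fin d, singularValue (prefixProd A ω (m n)) i ≤ Real.exp (n * a i)}
  have hG : ∀ᵐ ω ∂bernoulli p, ∀ᶠ n in atTop, ω ∈ G n := by
    filter_upwards [hW, ha] with ω h1 h2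
    exact h1.and h2
  -- The surplus `δ` in the exponent of the measure makes the bad sets summable.
  have hsum : Summable fun n : ℕ => C * Real.exp (n * -δ) :=
    (Real.summable_exp_nat_mul_iff.2 (neg_lt_zero.2 hδ)).mul_left C
  refine ae_eventually_le_measure_ball (bernoulli p) (measurable_codingMap hA) hG
    (b := fun n => ENNReal.ofReal (C * Real.exp (n * -δ))) hsum.tsum_ofReal_ne_top fun n => ?_
  have hd : ∀ i : Fin d, (0 : ℝ) < d := fun i => Nat.cast_pos.2 i.pos
  -- In `s i`, the factor `d` absorbs the one in `hr`, and `e^{n g i}` shrinks the side `e^{n a i}`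
  -- to `e^{nL}`.
  obtain ⟨f, t, hft, hfr, hct⟩ := exists_code (v := v) hA hR0 hR (m n) (W n) (G := G n)
    (fun ω hω => hω.1) (a := fun i => Real.exp (n * a i)) (s := fun i => d * Real.exp (n * g i))
    (r := Real.exp (n * L)) (fun ω hω => hω.2)
    (fun i => mul_pos (hd i) (Real.exp_pos _))
    (fun i => by
      rw [mul_left_comm, ← Real.exp_add, ← mul_add]
      have := hag i
      gcongr)
    (Real.exp_pos _).le
  refine ⟨_, f, t, hft, hfr, ?_⟩
  have hprod : ∏ i : Fin d, (2 * (R * (d * Real.exp (n * g i))) + 2)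
      ≤ C * Real.exp (n * ∑ i, g i) := by
    have h1 : ∀ i : Fin d, 2 * (R * (d * Real.exp (n * g i))) + 2
        ≤ (2 * (R * d) + 2) * Real.exp (n * g i) := by
      intro i
      have := Real.one_le_exp (mul_nonneg (Nat.cast_nonneg n) (hg i))
      nlinarith
    refine (Finset.prod_le_prod (fun i _ => by positivity) fun i _ => h1 i).trans_eq ?_
    rw [Finset.prod_mul_distrib, ← Real.exp_sum, Finset.mul_sum]
    simp [hC]
  rw [← ENNReal.ofReal_natCast, ← ENNReal.ofReal_mul (Nat.cast_nonneg _)]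
  refine ENNReal.ofReal_le_ofReal ?_
  calc (t.card : ℝ) * Real.exp (-(n * (H + ∑ i, g i + δ)))
      ≤ (Real.exp (n * H) * (C * Real.exp (n * ∑ i, g i))) *
          Real.exp (-(n * (H + ∑ i, g i + δ))) := by
        refine mul_le_mul_of_nonneg_right (hct.trans ?_) (Real.exp_pos _).le
        exact mul_le_mul (hcard n) hprod
          (Finset.prod_nonneg fun i _ => by positivity) (Real.exp_pos _).le
    _ = C * Real.exp (n * -δ) := by
        rw [mul_left_comm, mul_assoc, ← Real.exp_add, ← Real.exp_add]
        congr 2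
        ring

/-- The upper local dimension of the self-affine measure is at most the dimension `d`. -/
theorem ae_upperLocalDim_codingMap_le_dim (p : PMF Λ) (v : Λ → EuclideanSpace ℝ (Fin d))
    (hA : ∀ l, ‖toOp (A l)‖ < 1) :
    ∀ᵐ x ∂(bernoulli p).map (codingMap A v),
      upperLocalDim ((bernoulli p).map (codingMap A v)) x ≤ ((d : ℝ) : EReal) := by
  have h : ∀ k : ℕ, ∀ᵐ x ∂(bernoulli p).map (codingMap A v),
      upperLocalDim ((bernoulli p).map (codingMap A v)) x
        ≤ ((d + 1 / ((k : ℝ) + 1) : ℝ) : EReal) := by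
    intro k
    -- Words of length `0`: a ball containing the whole attractor is cut at scale `e^{-n}`, with
    -- about `e^n` cuts in each direction.
    have := ae_upperLocalDim_codingMap_le p v hA (fun _ => 0) (fun _ => Finset.univ)
      (H := 0) (L := -1) (δ := 1 / ((k : ℝ) + 1)) le_rfl (by norm_num) (by positivity)
      (a := fun _ => 0) (g := fun _ => 1) (fun _ => zero_le_one) (fun _ => by norm_num)
      (fun n => by simp) (ae_of_all _ fun ω => Eventually.of_forall fun n => Finset.mem_univ _)
      (ae_of_all _ fun ω => Eventually.of_forall fun n i => by
        simpa [prefixProd] using (singularValue_le_norm _ i.2).trans norm_toOp_one_le)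
    simpa using this
  filter_upwards [ae_all_iff.2 h] with x hx
  refine ge_of_tendsto' (x := atTop) ?_ hx
  refine EReal.tendsto_coe.2 ?_
  simpa using tendsto_one_div_add_atTop_nhds_zero_nat.const_add (d : ℝ)

/-- The scale is `e^{n(γ k + δ)}`, so direction `i` costs the rate `max (γ i - γ k) 0`. Monotonicity
of the exponents makes this vanish for `i ≥ k`. -/
theorem ae_upperLocalDim_codingMap_le_of_index (p : PMF Λ) (hp : ∀ l, 0 < p l)
    (v : Λ → EuclideanSpace ℝ (Fin d)) (hA : ∀ l, ‖toOp (A l)‖ < 1) {k : ℕ} (hk : k < d) :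
    ∀ᵐ x ∂(bernoulli p).map (codingMap A v),
      upperLocalDim ((bernoulli p).map (codingMap A v)) x
        ≤ ((k - entropySum p A k / lyapunovExponent p A k : ℝ) : EReal) := by
  set γ := lyapunovExponent p A with hγ
  have hγk : γ k < 0 := lyapunovExponent_neg p hA hk
  have hsum : ∑ i : Fin d, max (γ i - γ k) 0 = ∑ j ∈ Finset.range k, γ j - k * γ k := by
    rw [Fin.sum_univ_eq_sum_range (fun i => max (γ i - γ k) 0) d,
      ← Finset.sum_subset (Finset.range_subset_range.2 hk.le)]
    · rw [Finset.sum_congr rfl fun j hj => max_eq_left (sub_nonneg.2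
        (lyapunovExponent_antitone p hA (Finset.mem_range.1 hj).le hk))]
      simp [Finset.sum_sub_distrib, hγ]
    · intro j hj hjk
      refine max_eq_right (sub_nonpos.2 (lyapunovExponent_antitone p hA ?_
        (Finset.mem_range.1 hj)))
      simpa using hjk
  have h : ∀ δ : ℝ, 0 < δ → γ k + δ < 0 → ∀ᵐ x ∂(bernoulli p).map (codingMap A v),
      upperLocalDim ((bernoulli p).map (codingMap A v)) x
        ≤ (((entropySum p A k - k * γ k + 2 * δ) / -(γ k + δ) : ℝ) : EReal) := by
    intro δ hδ hL
    have := ae_upperLocalDim_codingMap_le p v hA (fun n => n)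
      (fun n => likelyWords p (entropy p + δ) n) (H := entropy p + δ) (L := γ k + δ) (δ := δ)
      (add_nonneg (entropy_nonneg p) hδ.le) hL hδ
      (a := fun i => γ i + δ) (g := fun i => max (γ i - γ k) 0) (fun i => le_max_right _ _)
      (fun i => by linarith [le_max_left (γ i - γ k) 0])
      (fun n => card_likelyWords_le p _ n) (ae_eventually_mem_likelyWords p hp hδ)
      (ae_eventually_singularValue_le p hA hδ)
    rw [hsum] at this
    convert this using 5
    rw [entropySum]
    ring
  -- A sequence of `δ` keeps the exceptional sets countable in number; staying below `-γ k` keeps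
  -- the scale exponent negative.
  obtain ⟨u, -, hu0, hu⟩ := exists_seq_strictAnti_tendsto' (neg_pos.2 hγk)
  have hall : ∀ n, ∀ᵐ x ∂(bernoulli p).map (codingMap A v),
      upperLocalDim ((bernoulli p).map (codingMap A v)) x
        ≤ (((entropySum p A k - k * γ k + 2 * u n) / -(γ k + u n) : ℝ) : EReal) := fun n =>
    h (u n) (hu0 n).1 (by linarith [(hu0 n).2])
  filter_upwards [ae_all_iff.2 hall] with x hx
  refine ge_of_tendsto' (x := atTop) (EReal.tendsto_coe.2 ?_) hx
  have hlim : Tendsto (fun n => (entropySum p A k - k * γ k + 2 * u n) / -(γ k + u n)) atTop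
      (𝓝 ((entropySum p A k - k * γ k + 2 * 0) / -(γ k + 0))) :=
    ((hu.const_mul 2).const_add _).div (hu.const_add _).neg (by simpa using hγk.ne)
  convert hlim using 2
  rw [mul_zero, add_zero, add_zero, eq_div_iff (neg_ne_zero.2 hγk.ne), mul_neg, sub_mul,
    div_mul_cancel₀ _ hγk.ne]
  ring

end Rates

end SelfAffine

theorem lemma3p6 {Λ : Type*} [Fintype Λ] [Nontrivial Λ] [MeasurableSpace Λ]
    [DiscreteMeasurableSpace Λ] (d : ℕ) (hd : 2 ≤ d)
    (A : Λ → GL (Fin d) ℝ) (hA : ∀ l, ‖SelfAffine.toOp (A l)‖ < 1)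
    (p : PMF Λ) (hp : ∀ l, 0 < p l)
    (v : Λ → EuclideanSpace ℝ (Fin d)) :
    ∀ᵐ x ∂((SelfAffine.bernoulli p).map (SelfAffine.codingMap A v)),
      SelfAffine.upperLocalDim ((SelfAffine.bernoulli p).map (SelfAffine.codingMap A v)) x
        ≤ (SelfAffine.lyapunovDim p A : EReal) := by
  unfold SelfAffine.lyapunovDim
  split_ifs with hk
  · exact SelfAffine.ae_upperLocalDim_codingMap_le_of_index p hp v hA hk
  · filter_upwards [SelfAffine.ae_upperLocalDim_codingMap_le_dim p v hA] with x hx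
    refine hx.trans (EReal.coe_le_coe_iff.2 ?_)
    have hbdd : BddAbove {i : ℕ | i ≤ d ∧ 0 < SelfAffine.entropySum p A i} := ⟨d, fun i hi => hi.1⟩
    -- If the set were empty, its `sSup` would be `0 < d`, which belongs to the other case.
    have hne : {i : ℕ | i ≤ d ∧ 0 < SelfAffine.entropySum p A i}.Nonempty := by
      by_contra h
      rw [Set.not_nonempty_iff_eq_empty] at h
      rw [SelfAffine.lyapunovIndex, h, csSup_empty] at hk
      exact hk (by simp; omega)
    have hmem := Nat.sSup_mem hne hbdd
    rw [show sSup {i : ℕ | i ≤ d ∧ 0 < SelfAffine.entropySum p A i} = d from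
      le_antisymm hmem.1 (not_lt.1 hk)] at hmem
    have hpos := hmem.2
    rw [SelfAffine.entropySum] at hpos
    have hneg : ∑ j ∈ Finset.range d, SelfAffine.lyapunovExponent p A j < 0 :=
      Finset.sum_neg (fun j hj => SelfAffine.lyapunovExponent_neg p hA (Finset.mem_range.1 hj))
        ⟨0, Finset.mem_range.2 (by omega)⟩
    -- Positivity of `h + γ_1 + ⋯ + γ_d` makes this quotient at most `-1`, so the Lyapunov dimension
    -- is at least `d`.
    have h1 : SelfAffine.entropy p /
        ∑ j ∈ Finset.range d, SelfAffine.lyapunovExponent p A j ≤ -1 := by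
      rw [div_le_iff_of_neg hneg]
      linarith
    nlinarith [(Nat.cast_nonneg d : (0 : ℝ) ≤ d)]
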